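/- Let $k$ be an algebraically closed field of characteristic zero, and let $R = k[x_0,x_1,y_0,y_1]$ be bigraded by $\deg x_i = (1,0)$ and $\deg y_i = (0,1)$. Let $\mathbb{X} \subseteq \mathbb{P}^1 \times \mathbb{P}^1$ be a nonempty finite set of points over $k$, let $I_{\mathbb{X}} \subseteq R$ be the ideal generated by all bihomogeneous forms that vanish at every point of $\mathbb{X}$, and let $H_{\mathbb{X}}(i,j) = \dim_k (R/I_{\mathbb{X}})_{(i,j)}$ for $(i,j)\in\mathbb{N}^2$ be the Hilbert function of $\mathbb{X}$. Put $$\Delta H_{\mathbb{X}}(i,j) = H_{\mathbb{X}}(i,j) - H_{\mathbb{X}}(i-1,j) - H_{\mathbb{X}}(i,j-1) + H_{\mathbb{X}}(i-1,j-1),$$ where $H_{\mathbb{X}}$ is taken to be $0$ at indices with a negative entry. The set $\mathbb{X}$ is called arithmetically Cohen-Macaulay (ACM) if $\dim R/I_{\mathbb{X}} = \operatorname{depth} R/I_{\mathbb{X}} = 2$, where $\dim$ is the Krull dimension and the depth is the supremum of the lengths of the $R/I_{\mathbb{X}}$-regular sequences contained in $(x_0,x_1,y_0,y_1)$. Then $\mathbb{X}$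 is ACM if and only if $\Delta H_{\mathbb{X}}$ is the Hilbert function of a bigraded artinian quotient of $k[x_1,y_1]$, that is, if and only if there is a bihomogeneous ideal $J \subseteq k[x_1,y_1]$ (with $\deg x_1 = (1,0)$, $\deg y_1 = (0,1)$) such that $k[x_1,y_1]/J$ is artinian and $\Delta H_{\mathbb{X}}(i,j) = \dim_k (k[x_1,y_1]/J)_{(i,j)}$ for all $(i,j) \in \mathbb{N}^2$. -/

import Mathlib

open scoped LinearAlgebra.Projectivization

noncomputable section

namespace BigradedPoints

attribute [local instance] MvPolynomial.weightedGradedAlgebra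

/-- The bigraded coordinate ring `k[x₀, x₁, y₀, y₁]` of `ℙ¹ × ℙ¹`: the variable `x_j` is `Sum.inl j`
and `y_j` is `Sum.inr j`. -/
abbrev CoordRing (k : Type*) [Field k] : Type _ := MvPolynomial (Fin 2 ⊕ Fin 2) k

/-- The bidegrees of the variables of `k[x₀, x₁, y₀, y₁]`: `deg x_j = (1, 0)`, `deg y_j = (0, 1)`. -/
def coordDeg : Fin 2 ⊕ Fin 2 → ℕ × ℕ := Sum.elim (fun _ => (1, 0)) (fun _ => (0, 1))

/-- The bidegrees of the two variables of `k[x₁, y₁]` (`x₁` has index `0`, `y₁` has index `1`):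
`deg x₁ = (1, 0)`, `deg y₁ = (0, 1)`. -/
def artinDeg : Fin 2 → ℕ × ℕ := ![(1, 0), (0, 1)]

/-- A polynomial vanishes at the point `P` of `ℙ¹ × ℙ¹` if it vanishes at every choice of
homogeneous coordinates of `P` (for a bihomogeneous form one choice is enough). -/
def VanishesAt {k : Type*} [Field k] (f : CoordRing k)
    (P : ℙ k (Fin 2 → k) × ℙ k (Fin 2 → k)) : Prop :=
  ∀ (a b : Fin 2 → k) (ha : a ≠ 0) (hb : b ≠ 0),
    Projectivization.mk k a ha = P.1 → Projectivization.mk k b hb = P.2 →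
      MvPolynomial.eval (Sum.elim a b) f = 0

/-- The ideal `I_X` generated by all bihomogeneous forms that vanish at all points of `X`. -/
def idealOfPoints {k : Type*} [Field k]
    (X : Finset (ℙ k (Fin 2 → k) × ℙ k (Fin 2 → k))) : Ideal (CoordRing k) :=
  Ideal.span {f | (∃ d : ℕ × ℕ, MvPolynomial.IsWeightedHomogeneous coordDeg f d) ∧
    ∀ P ∈ X, VanishesAt f P}

/-- The bigraded Hilbert function of `k[σ]/I`, where the variable `s` has bidegree `w s`: its value
at `d` is the `k`-dimension of the image of the forms of bidegree `d` in `k[σ]/I`. -/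
def hilbertFunction {k σ : Type*} [Field k] (w : σ → ℕ × ℕ) (I : Ideal (MvPolynomial σ k))
    (d : ℕ × ℕ) : ℕ :=
  Module.finrank k
    ((MvPolynomial.weightedHomogeneousSubmodule k w d).map (Ideal.Quotient.mkₐ k I).toLinearMap)

/-- The first difference function `ΔH(i) = ∑_{0 ≤ l ≤ (1, 1)} (-1)^|l| H(i - l)`, where `H` is
extended by zero to indices with a negative entry. -/
def firstDifference (H : ℕ × ℕ → ℕ) (i : ℕ × ℕ) : ℤ :=
  ∑ l₁ ∈ Finset.range 2, ∑ l₂ ∈ Finset.range 2,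
    (-1) ^ (l₁ + l₂) * (if l₁ ≤ i.1 ∧ l₂ ≤ i.2 then (H (i.1 - l₁, i.2 - l₂) : ℤ) else 0)

/-- The depth of the module `M` with respect to the ideal `𝔞`: the supremum of the lengths of the
`M`-regular sequences contained in `𝔞`. -/
def depth {A : Type*} [CommRing A] (𝔞 : Ideal A) (M : Type*) [AddCommGroup M] [Module A M] : ℕ∞ :=
  ⨆ (rs : List A) (_ : (∀ r ∈ rs, r ∈ 𝔞) ∧ RingTheory.Sequence.IsRegular M rs), (rs.length : ℕ∞)

/-- The homogeneous maximal ideal `(x₀, x₁, y₀, y₁)`. -/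
def maxHomogeneousIdeal (k : Type*) [Field k] : Ideal (CoordRing k) :=
  Ideal.span (Set.range MvPolynomial.X)

/-- `X` is arithmetically Cohen-Macaulay: `dim R/I_X = depth R/I_X = 2`. -/
def IsACM {k : Type*} [Field k] (X : Finset (ℙ k (Fin 2 → k) × ℙ k (Fin 2 → k))) : Prop :=
  ringKrullDim (CoordRing k ⧸ idealOfPoints X) = 2 ∧
    depth (maxHomogeneousIdeal k) (CoordRing k ⧸ idealOfPoints X) = 2

/-- `F` is the Hilbert function of a bigraded artinian quotient `k[x₁, y₁]/J`. -/
def IsHilbertFunctionOfArtinianQuotient (k : Type*) [Field k] (F : ℕ × ℕ → ℤ) : Prop :=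
  ∃ J : Ideal (MvPolynomial (Fin 2) k),
    J.IsHomogeneous (MvPolynomial.weightedHomogeneousSubmodule k artinDeg) ∧
    IsArtinianRing (MvPolynomial (Fin 2) k ⧸ J) ∧
    ∀ d : ℕ × ℕ, F d = (hilbertFunction artinDeg J d : ℤ)

end BigradedPoints

end

/-! Write `I` for the ideal of the points, `L = x₀ - c x₁` and `L' = y₀ - d y₁`, where `(c : 1)` and
`(d : 1)` are coordinates of no point. Then `L` is a nonzerodivisor on `R/I`. Once `L'` is also a
nonzerodivisor modulo `I₁ = I + (L)`, two exact sequences show that `ΔH` is the Hilbert function of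
`R/I₂`, where `I₂ = I₁ + (L')`. Modulo `L` and `L'` only `x₁` and `y₁` survive, so this is a
monomial quotient of `k[x₁, y₁]`. It is artinian because powers of both variables lie in `I₂`.

If the depth is two, `L'` is regular modulo `I₁`: otherwise `R/I₁` would contain a nonzero element
killed by the maximal ideal (`mem_of_yForm_mul_mem_of_depth_eq_two`), which `mem_of_forall_mul_mem`
excludes.

For the converse, `ΔH ≥ 0` suffices, provided `(c, d)` is generic
(`mem_of_yForm_mul_mem_of_firstDifference_nonneg`). In a bidegree where `I` has a nonzero form,
genericity makes `R/I₂` vanish, so multiplication by `L'` is onto that piece of `R/I₁`, and `ΔH ≥ 0`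
makes it injective by counting dimensions. In every other bidegree `I₁` agrees with the prime ideal
`(L)`, modulo which `L'` is regular. The regular pair `L, L'` and the integrality of `R/I` over
`k[L, L']` then fix both depth and dimension at two. -/

namespace BigradedPoints

open MvPolynomial RingTheory.Sequence

attribute [local instance] MvPolynomial.weightedGradedAlgebra

/-! ### Hilbert functions and the adjunction of one form to a homogeneous ideal. -/

section Graded

variable {k σ : Type*} [Field k] {w : σ → ℕ × ℕ}

lemma finite_weightedHomogeneousSubmodule [Finite σ] (hw : ∀ s, w s ≠ 0) (d : ℕ × ℕ) :
    Module.Finite k (weightedHomogeneousSubmodule k w d) := by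
  have hfin : {m : σ →₀ ℕ | Finsupp.weight w m = d}.Finite := by
    refine (Finsupp.finite_of_nat_weight_le (fun s => (w s).1 + (w s).2) (fun s hs => hw s ?_)
      (d.1 + d.2)).subset fun m hm => ?_
    · exact Prod.ext (by simp at hs; simp [hs.1]) (by simp at hs; simp [hs.2])
    · rw [Set.mem_ofPred_eq] at hm ⊢
      rw [← hm]
      simp [Finsupp.weight_apply, Finsupp.sum, Prod.fst_sum, Prod.snd_sum, mul_add,
        Finset.sum_add_distrib]
  refine Module.Finite.of_fg ?_
  have hspan : weightedHomogeneousSubmodule k w d =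
      Submodule.span k ((fun m => monomial m (1 : k)) '' {m | Finsupp.weight w m = d}) := by
    refine le_antisymm (fun f hf => ?_) (Submodule.span_le.2 ?_)
    · rw [f.as_sum]
      refine Submodule.sum_mem _ fun m hm => ?_
      rw [← mul_one (coeff m f), ← smul_eq_mul, ← smul_monomial]
      exact Submodule.smul_mem _ _ (Submodule.subset_span ⟨m, hf (mem_support_iff.1 hm), rfl⟩)
    · rintro _ ⟨m, hm, rfl⟩
      exact isWeightedHomogeneous_monomial w m 1 hm
  rw [hspan]
  exact Submodule.fg_span (hfin.image _)

lemma weightedHomogeneousComponent_mul_of_left {L g : MvPolynomial σ k} {e : ℕ × ℕ}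
    (hL : IsWeightedHomogeneous w L e) (d : ℕ × ℕ) :
    weightedHomogeneousComponent w (d + e) (L * g) = L * weightedHomogeneousComponent w d g := by
  have h := DirectSum.coe_decompose_mul_add_of_left_mem (weightedHomogeneousSubmodule k w)
    (i := e) (j := d) (a := L) (b := g) hL
  rw [add_comm d e, ← weightedDecomposition.decompose'_apply k w (L * g),
    ← weightedDecomposition.decompose'_apply k w g]
  exact h

lemma weightedHomogeneousComponent_mul_of_not_le {L g : MvPolynomial σ k} {d e : ℕ × ℕ}
    (hL : IsWeightedHomogeneous w L e) (h : ¬ e ≤ d) :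
    weightedHomogeneousComponent w d (L * g) = 0 :=
  (weightedDecomposition.decompose'_apply k w (L * g) d).symm.trans <|
    DirectSum.coe_decompose_mul_of_left_mem_of_not_le (weightedHomogeneousSubmodule k w)
    (a := L) (b := g) hL h

lemma isHomogeneous_sup_span {I : Ideal (MvPolynomial σ k)}
    (hI : I.IsHomogeneous (weightedHomogeneousSubmodule k w)) {L : MvPolynomial σ k} {e : ℕ × ℕ}
    (hL : IsWeightedHomogeneous w L e) :
    (I ⊔ Ideal.span {L}).IsHomogeneous (weightedHomogeneousSubmodule k w) := by
  refine hI.sup (Ideal.homogeneous_span _ _ ?_)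
  rintro _ rfl
  exact ⟨e, hL⟩

/-- If `f * L ∈ I` forces `f ∈ I` for all forms `f`, it does so for all polynomials `f`. -/
lemma mem_of_mul_mem_of_forall_isWeightedHomogeneous {I : Ideal (MvPolynomial σ k)}
    (hI : I.IsHomogeneous (weightedHomogeneousSubmodule k w)) {L : MvPolynomial σ k} {e : ℕ × ℕ}
    (hL : IsWeightedHomogeneous w L e)
    (h : ∀ d f, IsWeightedHomogeneous w f d → L * f ∈ I → f ∈ I) (f : MvPolynomial σ k)
    (hf : L * f ∈ I) : f ∈ I := by
  rw [mem_iff_weightedHomogeneousComponent_mem k w hI]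
  intro d
  refine h d _ (weightedHomogeneousComponent_isWeightedHomogeneous d f) ?_
  rw [← weightedHomogeneousComponent_mul_of_left hL]
  exact weightedHomogeneousComponent_mem_of_mem k w hI hf _

lemma hilbertFunction_add_finrank_inf [Finite σ] (hw : ∀ s, w s ≠ 0)
    (I : Ideal (MvPolynomial σ k)) (d : ℕ × ℕ) :
    hilbertFunction w I d + Module.finrank k
      (weightedHomogeneousSubmodule k w d ⊓ I.restrictScalars k : Submodule k _) =
      Module.finrank k (weightedHomogeneousSubmodule k w d) := by
  have := finite_weightedHomogeneousSubmodule (k := k) hw d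
  set V := weightedHomogeneousSubmodule k w d
  set q := (Ideal.Quotient.mkₐ k I).toLinearMap
  have h := (q.domRestrict V).finrank_range_add_finrank_ker
  rw [LinearMap.range_domRestrict, LinearMap.ker_domRestrict] at h
  rw [← h]
  congr 1
  have hk : LinearMap.ker q = I.restrictScalars k := by
    ext f
    simp [q, Ideal.Quotient.eq_zero_iff_mem]
  rw [hk]
  have e := Submodule.equivMapOfInjective V.subtype V.injective_subtype
    ((I.restrictScalars k).comap V.subtype)
  rw [e.finrank_eq, Submodule.map_comap_subtype]

lemma weightedHomogeneousSubmodule_inf_sup_span {I : Ideal (MvPolynomial σ k)}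
    (hI : I.IsHomogeneous (weightedHomogeneousSubmodule k w)) {L : MvPolynomial σ k} {e : ℕ × ℕ}
    (hL : IsWeightedHomogeneous w L e) (d : ℕ × ℕ) :
    weightedHomogeneousSubmodule k w (d + e) ⊓ (I ⊔ Ideal.span {L}).restrictScalars k =
      (weightedHomogeneousSubmodule k w (d + e) ⊓ I.restrictScalars k) ⊔
        (weightedHomogeneousSubmodule k w d).map (LinearMap.mulLeft k L) := by
  refine le_antisymm ?_ (sup_le ?_ ?_)
  · rintro f ⟨hf, hfI⟩
    obtain ⟨h, hh, _, hg, rfl⟩ := Submodule.mem_sup.1 (show f ∈ I ⊔ Ideal.span {L} from hfI)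
    obtain ⟨g, rfl⟩ := Ideal.mem_span_singleton.1 hg
    rw [← weightedHomogeneousComponent_eq_self (n := d + e) hf, map_add,
      weightedHomogeneousComponent_mul_of_left hL]
    refine Submodule.add_mem_sup ⟨weightedHomogeneousComponent_mem _ _ _,
      weightedHomogeneousComponent_mem_of_mem k w hI hh _⟩
      ⟨_, weightedHomogeneousComponent_mem _ _ _, rfl⟩
  · exact inf_le_inf_left _ (fun f hf => Ideal.mem_sup_left hf)
  · rintro _ ⟨f, hf, rfl⟩
    refine ⟨?_, Ideal.mem_sup_right (Ideal.mul_mem_right _ _ (Ideal.mem_span_singleton_self L))⟩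
    rw [add_comm]
    exact hL.mul hf

/-- The effect of adding a form `L` to `I` on the Hilbert function, in terms of the kernel of
multiplication by `L`. -/
lemma hilbertFunction_sup_span [Finite σ] (hw : ∀ s, w s ≠ 0) {I : Ideal (MvPolynomial σ k)}
    (hI : I.IsHomogeneous (weightedHomogeneousSubmodule k w)) {L : MvPolynomial σ k} {e : ℕ × ℕ}
    (hL : IsWeightedHomogeneous w L e) (hL0 : L ≠ 0) (d : ℕ × ℕ) :
    hilbertFunction w (I ⊔ Ideal.span {L}) (d + e) + hilbertFunction w I d +
        Module.finrank k (weightedHomogeneousSubmodule k w d ⊓ I.restrictScalars k :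
          Submodule k _) =
      hilbertFunction w I (d + e) + Module.finrank k (weightedHomogeneousSubmodule k w d ⊓
        (I.restrictScalars k).comap (LinearMap.mulLeft k L) : Submodule k _) := by
  have h1 := finite_weightedHomogeneousSubmodule (k := k) hw d
  have h2 := finite_weightedHomogeneousSubmodule (k := k) hw (d + e)
  have hinj : Function.Injective (LinearMap.mulLeft k L) := fun a b h => mul_left_cancel₀ hL0 h
  have e1 := hilbertFunction_add_finrank_inf hw (I ⊔ Ideal.span {L}) (d + e)
  have e2 := hilbertFunction_add_finrank_inf hw I (d + e)
  have e3 := hilbertFunction_add_finrank_inf hw I d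
  rw [weightedHomogeneousSubmodule_inf_sup_span hI hL] at e1
  -- The forms of degree `d + e` in `I + (L)` are the sum of those in `I` and `L` times the forms of
  -- degree `d`. The two summands meet in `L` times the degree `d` part of `(I : L)`, and
  -- multiplication by `L ≠ 0` preserves dimensions.
  have e4 := Submodule.finrank_sup_add_finrank_inf_eq
    (weightedHomogeneousSubmodule k w (d + e) ⊓ I.restrictScalars k)
    ((weightedHomogeneousSubmodule k w d).map (LinearMap.mulLeft k L))
  have e5 : (weightedHomogeneousSubmodule k w (d + e) ⊓ I.restrictScalars k) ⊓
      ((weightedHomogeneousSubmodule k w d).map (LinearMap.mulLeft k L)) =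
      (weightedHomogeneousSubmodule k w d ⊓
        (I.restrictScalars k).comap (LinearMap.mulLeft k L)).map (LinearMap.mulLeft k L) := by
    ext f
    constructor
    · rintro ⟨⟨-, h⟩, g, hg, rfl⟩
      exact ⟨g, ⟨hg, h⟩, rfl⟩
    · rintro ⟨g, ⟨hg, h⟩, rfl⟩
      refine ⟨⟨?_, h⟩, g, hg, rfl⟩
      rw [add_comm]
      exact hL.mul hg
  rw [e5, (Submodule.equivMapOfInjective _ hinj _).finrank_eq.symm,
    (Submodule.equivMapOfInjective _ hinj _).finrank_eq.symm] at e4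
  omega

lemma hilbertFunction_sup_span_of_regular [Finite σ] (hw : ∀ s, w s ≠ 0)
    {I : Ideal (MvPolynomial σ k)}
    (hI : I.IsHomogeneous (weightedHomogeneousSubmodule k w)) {L : MvPolynomial σ k} {e : ℕ × ℕ}
    (hL : IsWeightedHomogeneous w L e) (hL0 : L ≠ 0) (hreg : ∀ f, L * f ∈ I → f ∈ I)
    (d : ℕ × ℕ) :
    hilbertFunction w (I ⊔ Ideal.span {L}) (d + e) + hilbertFunction w I d =
      hilbertFunction w I (d + e) := by
  have h := hilbertFunction_sup_span hw hI hL hL0 d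
  have : (weightedHomogeneousSubmodule k w d ⊓ (I.restrictScalars k).comap
      (LinearMap.mulLeft k L) : Submodule k _) =
      weightedHomogeneousSubmodule k w d ⊓ I.restrictScalars k :=
    le_antisymm (inf_le_inf_left _ fun f hf => hreg f hf)
      (inf_le_inf_left _ fun f hf => I.mul_mem_left L hf)
  rw [this] at h
  omega

/-- The dimension formula also reads backwards: the inequality forces the degree `d` parts of `I`
and `(I : L)` to coincide. It is a statement about a single degree, so regularity can be proved by
different arguments in different degrees. -/
lemma mem_of_mul_mem_of_hilbertFunction_le [Finite σ] (hw : ∀ s, w s ≠ 0)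
    {I : Ideal (MvPolynomial σ k)}
    (hI : I.IsHomogeneous (weightedHomogeneousSubmodule k w)) {L : MvPolynomial σ k} {e : ℕ × ℕ}
    (hL : IsWeightedHomogeneous w L e) (hL0 : L ≠ 0) {d : ℕ × ℕ}
    (hle : hilbertFunction w (I ⊔ Ideal.span {L}) (d + e) + hilbertFunction w I d ≤
      hilbertFunction w I (d + e)) {f : MvPolynomial σ k} (hf : IsWeightedHomogeneous w f d)
    (hLf : L * f ∈ I) : f ∈ I := by
  have h := hilbertFunction_sup_span hw hI hL hL0 d
  have := finite_weightedHomogeneousSubmodule (k := k) hw d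
  have heq := Submodule.eq_of_le_of_finrank_le
    (S₁ := weightedHomogeneousSubmodule k w d ⊓ I.restrictScalars k)
    (S₂ := weightedHomogeneousSubmodule k w d ⊓
      (I.restrictScalars k).comap (LinearMap.mulLeft k L))
    (inf_le_inf_left _ fun f hf => I.mul_mem_left L hf) (by omega)
  exact (heq.ge ⟨hf, hLf⟩).2

/-- Multiples of `L` have no component in such degrees. This matches the convention in
`firstDifference` that `H` is zero at negative indices. -/
lemma hilbertFunction_sup_span_of_not_le [Finite σ] (hw : ∀ s, w s ≠ 0)
    {I : Ideal (MvPolynomial σ k)}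
    (hI : I.IsHomogeneous (weightedHomogeneousSubmodule k w)) {L : MvPolynomial σ k} {d e : ℕ × ℕ}
    (hL : IsWeightedHomogeneous w L e) (h : ¬ e ≤ d) :
    hilbertFunction w (I ⊔ Ideal.span {L}) d = hilbertFunction w I d := by
  have e1 := hilbertFunction_add_finrank_inf hw (I ⊔ Ideal.span {L}) d
  have e2 := hilbertFunction_add_finrank_inf hw I d
  have : weightedHomogeneousSubmodule k w d ⊓ (I ⊔ Ideal.span {L}).restrictScalars k =
      weightedHomogeneousSubmodule k w d ⊓ I.restrictScalars k := by
    refine le_antisymm ?_ (inf_le_inf_left _ fun f hf => Ideal.mem_sup_left hf)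
    rintro f ⟨hf, hfI⟩
    refine ⟨hf, ?_⟩
    obtain ⟨h', hh, _, hg, rfl⟩ := Submodule.mem_sup.1 (show f ∈ I ⊔ Ideal.span {L} from hfI)
    obtain ⟨g, rfl⟩ := Ideal.mem_span_singleton.1 hg
    rw [← weightedHomogeneousComponent_eq_self (n := d) hf, map_add,
      weightedHomogeneousComponent_mul_of_not_le hL h, add_zero]
    exact weightedHomogeneousComponent_mem_of_mem k w hI hh _
  rw [this] at e1
  omega

end Graded

/-! ### The ideal of the points, and linear forms that avoid them. -/

section Forms

variable {k : Type*} [Field k]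

lemma coordDeg_ne_zero (s : Fin 2 ⊕ Fin 2) : coordDeg s ≠ 0 := by
  rcases s with s | s <;> simp [coordDeg]

/-- A form of bidegree `n` scales by `u ^ n.1 * v ^ n.2` when the first pair of coordinates is
multiplied by `u` and the second one by `v`. -/
lemma aeval_mul_of_isWeightedHomogeneous {S : Type*} [CommRing S] [Algebra k S] {f : CoordRing k}
    {n : ℕ × ℕ} (hf : IsWeightedHomogeneous coordDeg f n) (u v : S) (a b : Fin 2 → S) :
    aeval (Sum.elim (fun i => u * a i) (fun i => v * b i)) f =
      u ^ n.1 * v ^ n.2 * aeval (Sum.elim a b) f := by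
  rw [aeval_def, aeval_def, eval₂_eq', eval₂_eq', Finset.mul_sum]
  refine Finset.sum_congr rfl fun m hm => ?_
  have h := hf (mem_support_iff.1 hm)
  rw [Finsupp.weight_apply, Finsupp.sum_fintype _ _ (by simp)] at h
  have h1 := congrArg Prod.fst h
  have h2 := congrArg Prod.snd h
  simp [coordDeg] at h1 h2
  rw [← h1, ← h2]
  simp only [Fintype.prod_sum_type, Fin.prod_univ_two, Sum.elim_inl, Sum.elim_inr]
  ring

lemma isHomogeneous_idealOfPoints (Z : Finset (ℙ k (Fin 2 → k) × ℙ k (Fin 2 → k))) :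
    (idealOfPoints Z).IsHomogeneous (weightedHomogeneousSubmodule k coordDeg) :=
  Ideal.homogeneous_span _ _ fun _ hf => hf.1

/-- `VanishesAt` tests all homogeneous coordinates, so over an infinite field rescaling the two
pairs independently separates the bihomogeneous components: each of them vanishes too. -/
lemma mem_idealOfPoints_iff [Infinite k] {Z : Finset (ℙ k (Fin 2 → k) × ℙ k (Fin 2 → k))}
    {f : CoordRing k} : f ∈ idealOfPoints Z ↔ ∀ P ∈ Z, VanishesAt f P := by
  constructor
  · intro hf P hP a b ha hb hPa hPb
    have : idealOfPoints Z ≤ RingHom.ker (eval (Sum.elim a b)) :=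
      Ideal.span_le.2 fun g hg => hg.2 P hP a b ha hb hPa hPb
    exact this hf
  · intro hf
    rw [mem_iff_weightedHomogeneousComponent_mem k coordDeg (isHomogeneous_idealOfPoints Z)]
    intro n
    refine Ideal.subset_span ⟨⟨n, weightedHomogeneousComponent_isWeightedHomogeneous n f⟩, ?_⟩
    intro P hP a b ha hb hPa hPb
    -- In this polynomial the coefficient of `X₀ ^ n.1 * X₁ ^ n.2` is the value at `(a, b)` of the
    -- component of `f` of bidegree `n`.
    set p : MvPolynomial (Fin 2) k :=
      aeval (Sum.elim (fun i => X 0 * C (a i)) (fun i => X 1 * C (b i))) f with hp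
    have hp0 : p = 0 := by
      -- Only nonzero scalars give homogeneous coordinates of `P`; they still form an infinite grid.
      refine funext_set (s := fun _ => {0}ᶜ) (fun _ => (Set.finite_singleton 0).infinite_compl)
        fun x hx => ?_
      have h0 : x 0 ≠ 0 := hx 0 trivial
      have h1 : x 1 ≠ 0 := hx 1 trivial
      have := hf P hP (x 0 • a) (x 1 • b) (smul_ne_zero h0 ha) (smul_ne_zero h1 hb)
        (by rw [← hPa, Projectivization.mk_eq_mk_iff']; exact ⟨x 0, rfl⟩)
        (by rw [← hPb, Projectivization.mk_eq_mk_iff']; exact ⟨x 1, rfl⟩)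
      rw [map_zero, ← this, hp, ← coe_aeval_eq_eval, ← coe_aeval_eq_eval]
      have key : (aeval x).comp (aeval (Sum.elim (fun i => X 0 * C (a i))
          (fun i => X 1 * C (b i)))) = aeval (R := k) (Sum.elim (x 0 • a) (x 1 • b)) :=
        algHom_ext fun s => by rcases s with s | s <;> simp
      exact DFunLike.congr_fun key f
    have hcomp : ∀ m, aeval (Sum.elim (fun i => X 0 * C (a i)) (fun i => X 1 * C (b i)))
        (weightedHomogeneousComponent coordDeg m f) = monomial
          (Finsupp.single (0 : Fin 2) m.1 + Finsupp.single 1 m.2)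
          (eval (Sum.elim a b) (weightedHomogeneousComponent coordDeg m f)) := by
      intro m
      rw [aeval_mul_of_isWeightedHomogeneous
        (weightedHomogeneousComponent_isWeightedHomogeneous m f),
        X_pow_eq_monomial, X_pow_eq_monomial, monomial_mul, one_mul]
      have : aeval (Sum.elim (fun i => C (a i)) fun i => C (b i))
          (weightedHomogeneousComponent coordDeg m f) =
          (C (eval (Sum.elim a b) (weightedHomogeneousComponent coordDeg m f)) :
            MvPolynomial (Fin 2) k) := by
        rw [← coe_aeval_eq_eval]
        refine DFunLike.congr_fun (g := (Algebra.ofId k (MvPolynomial (Fin 2) k)).comp (aeval _))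
          (algHom_ext fun s => ?_) _
        rcases s with s | s <;> simp [Algebra.ofId_apply]
      rw [this, mul_comm, C_mul_monomial, mul_one]
    have hsum := congrArg (coeff (Finsupp.single (0 : Fin 2) n.1 + Finsupp.single 1 n.2)) hp0
    rw [hp, ← sum_weightedHomogeneousComponent coordDeg f,
      finsum_eq_sum _ (weightedHomogeneousComponent_finsupp f), map_sum, coeff_sum, coeff_zero,
      Finset.sum_eq_single n, hcomp, coeff_monomial, if_pos rfl] at hsum
    · exact hsum
    · intro m _ hmn
      rw [hcomp, coeff_monomial, if_neg]
      intro h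
      apply hmn
      have h0 := DFunLike.congr_fun h 0
      have h1 := DFunLike.congr_fun h 1
      simp at h0 h1
      exact Prod.ext h0 h1
    · intro hn
      have : weightedHomogeneousComponent coordDeg n f = 0 := by
        by_contra h
        exact hn ((Set.Finite.mem_toFinset _).2 h)
      rw [this, map_zero, coeff_zero]

/-- The form `x₀ - c x₁`. -/
noncomputable def xForm (c : k) : CoordRing k := X (Sum.inl 0) - C c * X (Sum.inl 1)

/-- The form `y₀ - d y₁`. -/
noncomputable def yForm (d : k) : CoordRing k := X (Sum.inr 0) - C d * X (Sum.inr 1)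

lemma isWeightedHomogeneous_xForm (c : k) :
    IsWeightedHomogeneous coordDeg (xForm c) (1, 0) := by
  refine (isWeightedHomogeneous_X k coordDeg (Sum.inl 0)).sub ?_
  exact (isWeightedHomogeneous_X k coordDeg (Sum.inl 1)).C_mul c

lemma isWeightedHomogeneous_yForm (d : k) :
    IsWeightedHomogeneous coordDeg (yForm d) (0, 1) := by
  refine (isWeightedHomogeneous_X k coordDeg (Sum.inr 0)).sub ?_
  exact (isWeightedHomogeneous_X k coordDeg (Sum.inr 1)).C_mul d

@[simp] lemma eval_xForm (c : k) (a b : Fin 2 → k) :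
    eval (Sum.elim a b) (xForm c) = a 0 - c * a 1 := by simp [xForm]

@[simp] lemma eval_yForm (d : k) (a b : Fin 2 → k) :
    eval (Sum.elim a b) (yForm d) = b 0 - d * b 1 := by simp [yForm]

lemma xForm_ne_zero (c : k) : xForm c ≠ 0 := fun h => by
  simpa [h] using eval_xForm c ![1, 0] 0

lemma yForm_ne_zero (d : k) : yForm d ≠ 0 := fun h => by
  simpa [h] using eval_yForm d 0 ![1, 0]

lemma xForm_mem_maxHomogeneousIdeal (c : k) : xForm c ∈ maxHomogeneousIdeal k :=
  sub_mem (Ideal.subset_span ⟨_, rfl⟩) (Ideal.mul_mem_left _ _ (Ideal.subset_span ⟨_, rfl⟩))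

lemma yForm_mem_maxHomogeneousIdeal (d : k) : yForm d ∈ maxHomogeneousIdeal k :=
  sub_mem (Ideal.subset_span ⟨_, rfl⟩) (Ideal.mul_mem_left _ _ (Ideal.subset_span ⟨_, rfl⟩))

/-- The point `(c : 1)` of `ℙ¹` is different from `p`. -/
def Avoids (c : k) (p : ℙ k (Fin 2 → k)) : Prop := p.rep 0 - c * p.rep 1 ≠ 0

lemma Avoids.ne_zero {c : k} {p : ℙ k (Fin 2 → k)} (h : Avoids c p) {a : Fin 2 → k} (ha : a ≠ 0)
    (hp : Projectivization.mk k a ha = p) : a 0 - c * a 1 ≠ 0 := by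
  obtain ⟨u, hu⟩ : ∃ u : k, u • a = p.rep := by
    rw [← Projectivization.mk_eq_mk_iff' k _ _ p.rep_nonzero ha, p.mk_rep, hp]
  intro h0
  apply h
  rw [← hu]
  simp only [Pi.smul_apply, smul_eq_mul]
  linear_combination u * h0

lemma sub_div_mul_eq_zero_of_avoids {c : k} {p : ℙ k (Fin 2 → k)} (h : Avoids c p) {a : Fin 2 → k}
    (ha : a ≠ 0) (hp : Projectivization.mk k a ha = p) :
    a 1 - p.rep 1 / (p.rep 0 - c * p.rep 1) * (a 0 - c * a 1) = 0 := by
  obtain ⟨u, hu⟩ : ∃ u : k, u • p.rep = a := by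
    rw [← Projectivization.mk_eq_mk_iff' k _ _ ha p.rep_nonzero, p.mk_rep, hp]
  have h' : p.rep 0 - c * p.rep 1 ≠ 0 := h
  rw [← hu]
  simp only [Pi.smul_apply, smul_eq_mul]
  rw [show u * p.rep 0 - c * (u * p.rep 1) = u * (p.rep 0 - c * p.rep 1) by ring, mul_left_comm,
    div_mul_cancel₀ _ h', sub_self]

variable {Z : Finset (ℙ k (Fin 2 → k) × ℙ k (Fin 2 → k))} {c d : k}

lemma mem_of_xForm_mul_mem [Infinite k] (hc : ∀ P ∈ Z, Avoids c P.1) (f : CoordRing k)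
    (hf : xForm c * f ∈ idealOfPoints Z) : f ∈ idealOfPoints Z := by
  rw [mem_idealOfPoints_iff] at hf ⊢
  intro P hP a b ha hb hPa hPb
  have h := hf P hP a b ha hb hPa hPb
  rw [map_mul, eval_xForm] at h
  exact (mul_eq_zero.1 h).resolve_left ((hc P hP).ne_zero ha hPa)

/-- Each point contributes the linear form vanishing on its first coordinate, normalised to be monic
in `x₁` over `k[x₀ - c x₁]`; this is possible since `x₀ - c x₁` does not vanish there. The product
yields both a power of `x₁` modulo `x₀ - c x₁` and an integral equation for `x₁`. -/
lemma exists_prod_sub_xForm_mem [Infinite k] (hc : ∀ P ∈ Z, Avoids c P.1) :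
    ∃ t : ℙ k (Fin 2 → k) × ℙ k (Fin 2 → k) → k,
      ∏ P ∈ Z, (X (Sum.inl 1) - C (t P) * xForm c) ∈ idealOfPoints Z := by
  refine ⟨fun P => P.1.rep 1 / (P.1.rep 0 - c * P.1.rep 1), ?_⟩
  rw [mem_idealOfPoints_iff]
  intro P hP a b ha hb hPa hPb
  rw [map_prod]
  refine Finset.prod_eq_zero hP ?_
  simpa using sub_div_mul_eq_zero_of_avoids (hc P hP) ha hPa

lemma exists_prod_sub_yForm_mem [Infinite k] (hd : ∀ P ∈ Z, Avoids d P.2) :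
    ∃ t : ℙ k (Fin 2 → k) × ℙ k (Fin 2 → k) → k,
      ∏ P ∈ Z, (X (Sum.inr 1) - C (t P) * yForm d) ∈ idealOfPoints Z := by
  refine ⟨fun P => P.2.rep 1 / (P.2.rep 0 - d * P.2.rep 1), ?_⟩
  rw [mem_idealOfPoints_iff]
  intro P hP a b ha hb hPa hPb
  rw [map_prod]
  refine Finset.prod_eq_zero hP ?_
  simpa using sub_div_mul_eq_zero_of_avoids (hd P hP) hb hPb

lemma pow_card_mem_of_prod_mem {A ι : Type*} [CommRing A] {I : Ideal A} {s : Finset ι} {x L : A}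
    {t : ι → A} (h : ∏ i ∈ s, (x - t i * L) ∈ I) (hL : L ∈ I) : x ^ s.card ∈ I := by
  rw [← Ideal.Quotient.eq_zero_iff_mem] at h hL ⊢
  simpa [map_prod, hL] using h

end Forms

/-! ### Quotients by two linear forms, and the generic choice of these forms. -/

section Generic

variable {k : Type*} [Field k]

lemma mk_xForm_eq {I : Ideal (CoordRing k)} {c : k} (h : xForm c ∈ I) :
    Ideal.Quotient.mk I (X (Sum.inl 0)) =
      Ideal.Quotient.mk I (X (Sum.inl 1)) * Ideal.Quotient.mk I (C c) := by
  rw [← map_mul, Ideal.Quotient.eq, mul_comm]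
  exact h

lemma mk_yForm_eq {I : Ideal (CoordRing k)} {d : k} (h : yForm d ∈ I) :
    Ideal.Quotient.mk I (X (Sum.inr 0)) =
      Ideal.Quotient.mk I (X (Sum.inr 1)) * Ideal.Quotient.mk I (C d) := by
  rw [← map_mul, Ideal.Quotient.eq, mul_comm]
  exact h

/-- Modulo `x₀ - c x₁` and `y₀ - d y₁`, a form `f` is its value at `((c : 1), (d : 1))` times a
power product of `x₁` and `y₁`. -/
lemma mk_eq_smul_of_isWeightedHomogeneous {I : Ideal (CoordRing k)} {c d : k} (hc : xForm c ∈ I)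
    (hd : yForm d ∈ I) {f : CoordRing k} {n : ℕ × ℕ} (hf : IsWeightedHomogeneous coordDeg f n) :
    Ideal.Quotient.mk I f = eval (Sum.elim ![c, 1] ![d, 1]) f •
      Ideal.Quotient.mk I (X (Sum.inl 1) ^ n.1 * X (Sum.inr 1) ^ n.2) := by
  have h := aeval_mul_of_isWeightedHomogeneous hf (Ideal.Quotient.mk I (X (Sum.inl 1)))
    (Ideal.Quotient.mk I (X (Sum.inr 1)))
    (fun i => algebraMap k _ ((![c, 1] : Fin 2 → k) i))
    (fun i => algebraMap k _ ((![d, 1] : Fin 2 → k) i))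
  -- Modulo the two linear forms, `(x₀, x₁) = x₁ (c, 1)` and `(y₀, y₁) = y₁ (d, 1)`, so this
  -- substitution is the quotient map.
  have key : aeval (R := k) (Sum.elim
      (fun i => Ideal.Quotient.mk I (X (Sum.inl 1)) * algebraMap k _ ((![c, 1] : Fin 2 → k) i))
      (fun i => Ideal.Quotient.mk I (X (Sum.inr 1)) * algebraMap k _ ((![d, 1] : Fin 2 → k) i))) =
      Ideal.Quotient.mkₐ k I := by
    refine algHom_ext fun s => ?_
    rcases s with s | s <;> fin_cases s
    · simpa using! (mk_xForm_eq hc).symm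
    · simp
    · simpa using! (mk_yForm_eq hd).symm
    · simp
  have key2 : aeval (R := k) (Sum.elim
      (fun i => algebraMap k (CoordRing k ⧸ I) ((![c, 1] : Fin 2 → k) i))
      (fun i => algebraMap k (CoordRing k ⧸ I) ((![d, 1] : Fin 2 → k) i))) =
      (Algebra.ofId k _).comp (aeval (Sum.elim ![c, 1] ![d, 1])) := by
    refine algHom_ext fun s => ?_
    rcases s with s | s <;> simp [Algebra.ofId_apply]
  rw [key, key2] at h
  refine Eq.trans ?_ (map_smul (Ideal.Quotient.mkₐ k I) _ _)
  rw [smul_eq_C_mul, map_mul, map_mul, map_pow, map_pow, mul_comm]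
  exact h

lemma pow_mul_pow_mem {I : Ideal (CoordRing k)} {c d : k} (hc : xForm c ∈ I)
    (hd : yForm d ∈ I) {f : CoordRing k} {n : ℕ × ℕ} (hf : IsWeightedHomogeneous coordDeg f n)
    (hfI : f ∈ I) (h0 : eval (Sum.elim ![c, 1] ![d, 1]) f ≠ 0) :
    X (Sum.inl 1) ^ n.1 * X (Sum.inr 1) ^ n.2 ∈ I := by
  have h := mk_eq_smul_of_isWeightedHomogeneous hc hd hf
  rw [Ideal.Quotient.eq_zero_iff_mem.2 hfI] at h
  rw [← Ideal.Quotient.eq_zero_iff_mem]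
  exact (smul_eq_zero.1 h.symm).resolve_left h0

lemma isWeightedHomogeneous_pow_mul_pow (n : ℕ × ℕ) :
    IsWeightedHomogeneous coordDeg
      (X (Sum.inl 1) ^ n.1 * X (Sum.inr 1) ^ n.2 : CoordRing k) n := by
  have h := ((isWeightedHomogeneous_X k coordDeg (Sum.inl 1)).pow n.1).mul
    ((isWeightedHomogeneous_X k coordDeg (Sum.inr 1)).pow n.2)
  have e : n.1 • coordDeg (Sum.inl 1) + n.2 • coordDeg (Sum.inr 1) = n := by
    ext <;> simp [coordDeg]
  rwa [e] at h

lemma hilbertFunction_eq_ite_of_forall_exists_smul {σ : Type*} {w : σ → ℕ × ℕ}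
    {I : Ideal (MvPolynomial σ k)}
    {n : ℕ × ℕ} {m : MvPolynomial σ k} (hm : IsWeightedHomogeneous w m n)
    (h : ∀ f, IsWeightedHomogeneous w f n → ∃ a : k,
      Ideal.Quotient.mk I f = a • Ideal.Quotient.mk I m) [Decidable (m ∈ I)] :
    hilbertFunction w I n = if m ∈ I then 0 else 1 := by
  have hspan : (weightedHomogeneousSubmodule k w n).map (Ideal.Quotient.mkₐ k I).toLinearMap =
      Submodule.span k {Ideal.Quotient.mk I m} := by
    refine le_antisymm ?_ (Submodule.span_le.2 ?_)
    · rintro _ ⟨f, hf, rfl⟩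
      obtain ⟨a, ha⟩ := h f hf
      exact Submodule.mem_span_singleton.2 ⟨a, ha.symm⟩
    · rintro _ rfl
      exact ⟨m, hm, rfl⟩
  rw [hilbertFunction, hspan]
  split_ifs with hmI
  · rw [Ideal.Quotient.eq_zero_iff_mem.2 hmI, Submodule.span_zero_singleton, finrank_bot]
  · exact finrank_span_singleton fun h0 => hmI (Ideal.Quotient.eq_zero_iff_mem.1 h0)

open Classical in
lemma hilbertFunction_coordDeg_eq {I : Ideal (CoordRing k)} {c d : k} (hc : xForm c ∈ I)
    (hd : yForm d ∈ I) (n : ℕ × ℕ) :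
    hilbertFunction coordDeg I n =
      if X (Sum.inl 1) ^ n.1 * X (Sum.inr 1) ^ n.2 ∈ I then 0 else 1 :=
  hilbertFunction_eq_ite_of_forall_exists_smul (isWeightedHomogeneous_pow_mul_pow n)
    fun _ hf => ⟨_, mk_eq_smul_of_isWeightedHomogeneous hc hd hf⟩

lemma isWeightedHomogeneous_artinDeg_pow_mul_pow (n : ℕ × ℕ) :
    IsWeightedHomogeneous artinDeg (X 0 ^ n.1 * X 1 ^ n.2 : MvPolynomial (Fin 2) k) n := by
  have h := ((isWeightedHomogeneous_X k artinDeg 0).pow n.1).mul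
    ((isWeightedHomogeneous_X k artinDeg 1).pow n.2)
  have e : n.1 • artinDeg 0 + n.2 • artinDeg 1 = n := by
    ext <;> simp [artinDeg]
  rwa [e] at h

lemma exists_eq_smul_of_isWeightedHomogeneous_artinDeg {f : MvPolynomial (Fin 2) k} {n : ℕ × ℕ}
    (hf : IsWeightedHomogeneous artinDeg f n) :
    ∃ a : k, f = a • (X 0 ^ n.1 * X 1 ^ n.2) := by
  refine ⟨coeff (Finsupp.single 0 n.1 + Finsupp.single 1 n.2) f, ?_⟩
  rw [X_pow_eq_monomial, X_pow_eq_monomial, monomial_mul, one_mul, smul_monomial, smul_eq_mul,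
    mul_one]
  refine hf.eq_monomial_of_unique_weight fun m hm => ?_
  rw [Finsupp.weight_apply, Finsupp.sum_fintype _ _ (by simp)] at hm
  have h1 := congrArg Prod.fst hm
  have h2 := congrArg Prod.snd hm
  simp [artinDeg] at h1 h2
  ext i
  fin_cases i
  · simp [h1]
  · simp [h2]

open Classical in
lemma hilbertFunction_artinDeg_eq (J : Ideal (MvPolynomial (Fin 2) k)) (n : ℕ × ℕ) :
    hilbertFunction artinDeg J n = if X 0 ^ n.1 * X 1 ^ n.2 ∈ J then 0 else 1 := by
  refine hilbertFunction_eq_ite_of_forall_exists_smul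
    (isWeightedHomogeneous_artinDeg_pow_mul_pow n) fun f hf => ?_
  obtain ⟨a, ha⟩ := exists_eq_smul_of_isWeightedHomogeneous_artinDeg hf
  refine ⟨a, ?_⟩
  conv_lhs => rw [ha]
  exact map_smul (Ideal.Quotient.mkₐ k J) a _

/-- The ideal of `k[x₁, y₁]` generated by the power products lying in `I ⊆ k[x₀, x₁, y₀, y₁]`. -/
noncomputable def monomialIdeal (I : Ideal (CoordRing k)) : Ideal (MvPolynomial (Fin 2) k) :=
  Ideal.span {f | ∃ n : ℕ × ℕ, X (Sum.inl 1) ^ n.1 * X (Sum.inr 1) ^ n.2 ∈ I ∧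
    f = X 0 ^ n.1 * X 1 ^ n.2}

lemma isHomogeneous_monomialIdeal (I : Ideal (CoordRing k)) :
    (monomialIdeal I).IsHomogeneous (weightedHomogeneousSubmodule k artinDeg) := by
  refine Ideal.homogeneous_span _ _ ?_
  rintro _ ⟨n, -, rfl⟩
  exact ⟨n, isWeightedHomogeneous_artinDeg_pow_mul_pow n⟩

/-- Generating an ideal adds no further power products, because the preimage of `I` under the
inclusion of `k[x₁, y₁]` is already an ideal containing the generators. -/
lemma pow_mul_pow_mem_monomialIdeal_iff (I : Ideal (CoordRing k)) (n : ℕ × ℕ) :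
    X 0 ^ n.1 * X 1 ^ n.2 ∈ monomialIdeal I ↔
      X (Sum.inl 1) ^ n.1 * X (Sum.inr 1) ^ n.2 ∈ I := by
  refine ⟨fun h => ?_, fun h => Ideal.subset_span ⟨n, h, rfl⟩⟩
  let ψ : MvPolynomial (Fin 2) k →ₐ[k] CoordRing k := aeval ![X (Sum.inl 1), X (Sum.inr 1)]
  have hle : monomialIdeal I ≤ I.comap ψ := by
    refine Ideal.span_le.2 ?_
    rintro _ ⟨m, hm, rfl⟩
    simpa [ψ] using hm
  simpa [ψ] using hle h

/-- Both generators are nilpotent, hence integral over `k`, so the quotient is finite-dimensional.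
-/
lemma isArtinianRing_quotient_of_pow_mem {J : Ideal (MvPolynomial (Fin 2) k)} {s : ℕ}
    (h0 : X 0 ^ s ∈ J) (h1 : X 1 ^ s ∈ J) : IsArtinianRing (MvPolynomial (Fin 2) k ⧸ J) := by
  have hint : Algebra.IsIntegral k (MvPolynomial (Fin 2) k ⧸ J) := by
    rw [← integralClosure_eq_top_iff, eq_top_iff]
    have hsurj : (Ideal.Quotient.mkₐ k J).range = ⊤ :=
      (AlgHom.range_eq_top _).2 (Ideal.Quotient.mkₐ_surjective k J)
    rw [← hsurj, ← Algebra.map_top, ← adjoin_range_X, AlgHom.map_adjoin]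
    refine Algebra.adjoin_le ?_
    rintro _ ⟨_, ⟨i, rfl⟩, rfl⟩
    refine ⟨Polynomial.X ^ s, Polynomial.monic_X_pow s, ?_⟩
    have : Ideal.Quotient.mk J (X i) ^ s = 0 := by
      rw [← map_pow, Ideal.Quotient.eq_zero_iff_mem]
      fin_cases i
      exacts [h0, h1]
    simpa using this
  have : Module.Finite k (MvPolynomial (Fin 2) k ⧸ J) := Algebra.IsIntegral.finite
  exact IsArtinianRing.of_finite k _

/-- Multiplying by `x₁ y₁` disposes of the points outside the affine chart; inside it, bihomogeneity
reduces to `x₁ = y₁ = 1`. -/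
lemma eq_zero_of_forall_eval_eq_zero [Infinite k] {f : CoordRing k} {n : ℕ × ℕ}
    (hf : IsWeightedHomogeneous coordDeg f n)
    (h : ∀ c d : k, eval (Sum.elim ![c, 1] ![d, 1]) f = 0) : f = 0 := by
  have h0 : f * (X (Sum.inl 1) * X (Sum.inr 1)) = 0 := by
    refine funext fun z => ?_
    rw [map_zero, map_mul, map_mul, eval_X, eval_X]
    by_cases h1 : z (Sum.inl 1) = 0
    · simp [h1]
    by_cases h2 : z (Sum.inr 1) = 0
    · simp [h2]
    have hz : z = Sum.elim
        (fun i => z (Sum.inl 1) * (![z (Sum.inl 0) / z (Sum.inl 1), 1] : Fin 2 → k) i)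
        (fun i => z (Sum.inr 1) * (![z (Sum.inr 0) / z (Sum.inr 1), 1] : Fin 2 → k) i) := by
      ext s
      rcases s with s | s <;> fin_cases s <;> simp <;> field_simp
    have hs := aeval_mul_of_isWeightedHomogeneous hf (z (Sum.inl 1)) (z (Sum.inr 1))
      ![z (Sum.inl 0) / z (Sum.inl 1), 1] ![z (Sum.inr 0) / z (Sum.inr 1), 1]
    rw [← hz] at hs
    have hs' : eval z f = 0 := by
      refine hs.trans ?_
      have := h (z (Sum.inl 0) / z (Sum.inl 1)) (z (Sum.inr 0) / z (Sum.inr 1))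
      exact mul_eq_zero_of_right _ this
    rw [hs', zero_mul]
  exact (mul_eq_zero.1 h0).resolve_right (mul_ne_zero (X_ne_zero _) (X_ne_zero _))

/-- A point `((c : 1), (d : 1))` whose coordinates are not coordinates of points of `Z` and at
which none of finitely many given nonzero forms vanishes. -/
lemma exists_avoids_and_eval_ne_zero [Infinite k]
    (Z : Finset (ℙ k (Fin 2 → k) × ℙ k (Fin 2 → k))) (s : Finset (ℕ × ℕ))
    (F : ℕ × ℕ → CoordRing k) (hF : ∀ n ∈ s, IsWeightedHomogeneous coordDeg (F n) n)
    (hF0 : ∀ n ∈ s, F n ≠ 0) :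
    ∃ c d : k, (∀ P ∈ Z, Avoids c P.1) ∧ (∀ P ∈ Z, Avoids d P.2) ∧
      ∀ n ∈ s, eval (Sum.elim ![c, 1] ![d, 1]) (F n) ≠ 0 := by
  -- Dehomogenisation turns all the conditions on `(c, d)` into the nonvanishing of one nonzero
  -- polynomial in two variables.
  let θ : CoordRing k →ₐ[k] MvPolynomial (Fin 2) k := aeval (Sum.elim ![X 0, 1] ![X 1, 1])
  have hθ : ∀ (c d : k) f, eval ![c, d] (θ f) = eval (Sum.elim ![c, 1] ![d, 1]) f := by
    intro c d f
    have key : (aeval ![c, d]).comp θ = aeval (R := k) (Sum.elim ![c, 1] ![d, 1]) := by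
      refine algHom_ext fun s => ?_
      rcases s with s | s <;> fin_cases s <;> simp [θ]
    exact DFunLike.congr_fun key f
  let ℓ : Fin 2 → ℙ k (Fin 2 → k) → MvPolynomial (Fin 2) k :=
    fun i p => C (p.rep 0) - X i * C (p.rep 1)
  have hℓ : ∀ i p, ℓ i p ≠ 0 := by
    intro i p h
    have e0 := congrArg (eval 0) h
    have e1 := congrArg (eval 1) h
    simp only [ℓ, map_sub, map_mul, eval_C, eval_X, map_zero, Pi.zero_apply, Pi.one_apply,
      zero_mul, sub_zero, one_mul] at e0 e1
    refine p.rep_nonzero (_root_.funext fun j => ?_)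
    fin_cases j
    · exact e0
    · simpa [e0] using e1
  have hQ : (∏ P ∈ Z, (ℓ 0 P.1 * ℓ 1 P.2)) * ∏ n ∈ s, θ (F n) ≠ 0 := by
    refine mul_ne_zero (Finset.prod_ne_zero_iff.2 fun P _ => mul_ne_zero (hℓ _ _) (hℓ _ _))
      (Finset.prod_ne_zero_iff.2 fun n hn h => hF0 n hn ?_)
    refine eq_zero_of_forall_eval_eq_zero (hF n hn) fun c d => ?_
    rw [← hθ, h, map_zero]
  obtain ⟨z, hz⟩ : ∃ z, eval z ((∏ P ∈ Z, (ℓ 0 P.1 * ℓ 1 P.2)) * ∏ n ∈ s, θ (F n)) ≠ 0 := by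
    by_contra! h
    exact hQ (funext fun z => by rw [h z, map_zero])
  have hz' : z = ![z 0, z 1] := by ext i; fin_cases i <;> rfl
  rw [map_mul, map_prod, map_prod] at hz
  have hz1 := Finset.prod_ne_zero_iff.1 (left_ne_zero_of_mul hz)
  have hz2 := Finset.prod_ne_zero_iff.1 (right_ne_zero_of_mul hz)
  refine ⟨z 0, z 1, fun P hP => ?_, fun P hP => ?_, fun n hn => ?_⟩
  · have := hz1 P hP
    rw [map_mul] at this
    simpa [ℓ, Avoids] using left_ne_zero_of_mul this
  · have := hz1 P hP
    rw [map_mul] at this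
    simpa [ℓ, Avoids] using right_ne_zero_of_mul this
  · rw [← hθ, ← hz']
    exact hz2 n hn

end Generic

/-! ### Regular sequences, depth and Krull dimension. -/

section Regular

variable {A : Type*} [CommRing A]

lemma isSMulRegular_quotient_iff {I : Ideal A} {r : A} :
    IsSMulRegular (A ⧸ I) r ↔ ∀ f, r * f ∈ I → f ∈ I := by
  rw [isSMulRegular_iff_right_eq_zero_of_smul]
  constructor
  · intro h f hf
    have := h (Ideal.Quotient.mk I f) (by
      rw [← Ideal.Quotient.eq_zero_iff_mem] at hf
      rw [← hf]
      rfl)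
    exact Ideal.Quotient.eq_zero_iff_mem.1 this
  · intro h x hx
    obtain ⟨f, rfl⟩ := Ideal.Quotient.mk_surjective x
    refine Ideal.Quotient.eq_zero_iff_mem.2 (h f (Ideal.Quotient.eq_zero_iff_mem.1 ?_))
    exact hx

lemma mk_mk_eq_zero_iff {I : Ideal A} {r f : A} :
    (Submodule.Quotient.mk (Ideal.Quotient.mk I f) : QuotSMulTop r (A ⧸ I)) = 0 ↔
      f ∈ I ⊔ Ideal.span {r} := by
  rw [Submodule.Quotient.mk_eq_zero, Submodule.mem_smul_pointwise_iff_exists]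
  constructor
  · rintro ⟨x, -, hx⟩
    obtain ⟨g, rfl⟩ := Ideal.Quotient.mk_surjective x
    have h : Ideal.Quotient.mk I (r * g) = Ideal.Quotient.mk I f := hx
    have h2 : f - r * g ∈ I := Ideal.Quotient.eq.1 h.symm
    rw [← sub_add_cancel f (r * g)]
    exact Submodule.add_mem_sup h2 (Ideal.mul_mem_right _ _ (Ideal.mem_span_singleton_self r))
  · intro h
    obtain ⟨a, ha, _, hb, rfl⟩ := Submodule.mem_sup.1 h
    obtain ⟨g, rfl⟩ := Ideal.mem_span_singleton.1 hb
    refine ⟨Ideal.Quotient.mk I g, trivial, ?_⟩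
    show Ideal.Quotient.mk I (r * g) = _
    rw [map_add, Ideal.Quotient.eq_zero_iff_mem.2 ha, zero_add]

lemma isSMulRegular_quotSMulTop_quotient_iff {I : Ideal A} {r s : A} :
    IsSMulRegular (QuotSMulTop r (A ⧸ I)) s ↔
      ∀ f, s * f ∈ I ⊔ Ideal.span {r} → f ∈ I ⊔ Ideal.span {r} := by
  rw [isSMulRegular_iff_right_eq_zero_of_smul]
  constructor
  · intro h f hf
    exact mk_mk_eq_zero_iff.1 (h (Submodule.Quotient.mk (Ideal.Quotient.mk I f))
      (mk_mk_eq_zero_iff.2 hf))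
  · intro h x hx
    obtain ⟨y, rfl⟩ := Submodule.Quotient.mk_surjective _ x
    obtain ⟨f, rfl⟩ := Ideal.Quotient.mk_surjective y
    exact mk_mk_eq_zero_iff.2 (h f (mk_mk_eq_zero_iff.1 hx))

/-- A regular element lies in no minimal prime of the module, so each term of the sequence lowers
the dimension by at least one. -/
lemma length_le_supportDim (rs : List A) (M : Type*) [AddCommGroup M] [Module A M]
    [Module.Finite A M] (h : IsRegular M rs) : (rs.length : WithBot ℕ∞) ≤ Module.supportDim A M := by
  induction rs generalizing M with
  | nil =>
    have := h.nontrivial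
    have h0 := Module.supportDim_ne_bot_of_nontrivial (R := A) (M := M)
    obtain ⟨n, hn⟩ := WithBot.ne_bot_iff_exists.1 h0
    rw [← hn]
    exact WithBot.coe_le_coe.2 zero_le
  | cons r rs ih =>
    rw [isRegular_cons_iff] at h
    refine le_trans ?_ (Module.supportDim_quotSMulTop_succ_le_of_notMem_minimalPrimes
      fun _ => h.1.notMem_of_mem_minimalPrimes)
    rw [List.length_cons, Nat.cast_add, Nat.cast_one]
    gcongr
    exact ih _ h.2

lemma depth_le_of_supportDim_le {𝔞 : Ideal A} {M : Type*} [AddCommGroup M] [Module A M]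
    [Module.Finite A M] {n : ℕ} (h : Module.supportDim A M ≤ n) : depth 𝔞 M ≤ n :=
  iSup₂_le fun rs hrs => by
    have := (length_le_supportDim rs M hrs.2).trans h
    exact_mod_cast this

lemma length_le_depth {𝔞 : Ideal A} {M : Type*} [AddCommGroup M] [Module A M] {rs : List A}
    (h : ∀ r ∈ rs, r ∈ 𝔞) (hrs : IsRegular M rs) : (rs.length : ℕ∞) ≤ depth 𝔞 M :=
  le_iSup₂_of_le rs ⟨h, hrs⟩ le_rfl

lemma exists_regular_pair_of_depth_eq_two {𝔞 I : Ideal A} (h : depth 𝔞 (A ⧸ I) = 2) :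
    ∃ r ∈ 𝔞, ∃ s ∈ 𝔞, (∀ f, r * f ∈ I → f ∈ I) ∧
      ∀ f, s * f ∈ I ⊔ Ideal.span {r} → f ∈ I ⊔ Ideal.span {r} := by
  have : ∃ rs : List A, ((∀ r ∈ rs, r ∈ 𝔞) ∧ IsRegular (A ⧸ I) rs) ∧ 2 ≤ rs.length := by
    by_contra! hcon
    have : depth 𝔞 (A ⧸ I) ≤ 1 := iSup₂_le fun rs hrs => by
      have := hcon rs hrs
      exact_mod_cast Nat.le_of_lt_succ this
    rw [h] at this
    exact absurd this (by decide)
  obtain ⟨rs, ⟨hmem, hreg⟩, hlen⟩ := this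
  match rs, hlen with
  | r :: s :: rs, _ =>
    rw [isRegular_cons_iff, isRegular_cons_iff] at hreg
    exact ⟨r, hmem r (by simp), s, hmem s (by simp), isSMulRegular_quotient_iff.1 hreg.1,
      isSMulRegular_quotSMulTop_quotient_iff.1 hreg.2.1⟩

lemma isRegular_pair {I : Ideal A} {r s : A} (h1 : ∀ f, r * f ∈ I → f ∈ I)
    (h2 : ∀ f, s * f ∈ I ⊔ Ideal.span {r} → f ∈ I ⊔ Ideal.span {r})
    (hne : I ⊔ Ideal.span {r} ⊔ Ideal.span {s} ≠ ⊤) : IsRegular (A ⧸ I) [r, s] := by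
  refine ⟨?_, ?_⟩
  · rw [isWeaklyRegular_cons_iff, isWeaklyRegular_singleton_iff]
    exact ⟨isSMulRegular_quotient_iff.2 h1, isSMulRegular_quotSMulTop_quotient_iff.2 h2⟩
  · intro h
    apply hne
    rw [Ideal.eq_top_iff_one, sup_assoc]
    have hmap : (Ideal.ofList [r, s] • ⊤ : Submodule A (A ⧸ I)) ≤
        Submodule.map (Submodule.mkQ I) (Ideal.span {r} ⊔ Ideal.span {s}) := by
      refine Submodule.smul_le.2 fun a ha x _ => ?_
      obtain ⟨g, rfl⟩ := Submodule.mkQ_surjective I x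
      refine ⟨a * g, Ideal.mul_mem_right _ _ ?_, rfl⟩
      simpa using ha
    obtain ⟨a, ha, ha1⟩ := hmap (h ▸ Submodule.mem_top : Submodule.mkQ I 1 ∈ _)
    rw [← sub_add_cancel 1 a]
    exact Submodule.add_mem_sup (Ideal.Quotient.eq.1 ha1.symm) ha

/-- If `A ⧸ I` has a regular sequence of length two in `𝔪`, then modulo any nonzerodivisor of
`A ⧸ I` in `𝔪` no nonzero element is annihilated by `𝔪`. -/
lemma mem_of_forall_mul_mem {𝔪 I : Ideal A} {r s L : A} (hr : r ∈ 𝔪) (hs : s ∈ 𝔪)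
    (h1 : ∀ f, r * f ∈ I → f ∈ I)
    (h2 : ∀ f, s * f ∈ I ⊔ Ideal.span {r} → f ∈ I ⊔ Ideal.span {r})
    (hL : ∀ f, L * f ∈ I → f ∈ I) {a : A} (ha : ∀ m ∈ 𝔪, m * a ∈ I ⊔ Ideal.span {L}) :
    a ∈ I ⊔ Ideal.span {L} := by
  have hmem : ∀ {t x : A}, x ∈ I ⊔ Ideal.span {t} ↔ ∃ y, x - t * y ∈ I := by
    intro t x
    constructor
    · intro h
      obtain ⟨u, hu, _, hv, rfl⟩ := Submodule.mem_sup.1 h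
      obtain ⟨g, rfl⟩ := Ideal.mem_span_singleton.1 hv
      exact ⟨g, by simpa using hu⟩
    · rintro ⟨y, hy⟩
      rw [← sub_add_cancel x (t * y)]
      exact Submodule.add_mem_sup hy (Ideal.mul_mem_right _ _ (Ideal.mem_span_singleton_self t))
  -- Modulo `I`, write `r a = L b` and `s a = L y`. Cancelling `L` gives `s b = r y`, so `b = r z`
  -- by regularity of `s` modulo `r`; cancelling `r` from `r a = L r z` gives `a = L z`.
  obtain ⟨b, hb⟩ := hmem.1 (ha r hr)
  obtain ⟨y, hy⟩ := hmem.1 (ha s hs)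
  have hsb : s * b ∈ I ⊔ Ideal.span {r} := by
    refine hmem.2 ⟨y, hL _ ?_⟩
    have : L * (s * b - r * y) = r * (s * a - L * y) - s * (r * a - L * b) := by ring
    rw [this]
    exact sub_mem (I.mul_mem_left _ hy) (I.mul_mem_left _ hb)
  obtain ⟨z, hz⟩ := hmem.1 (h2 b hsb)
  refine hmem.2 ⟨z, h1 _ ?_⟩
  have : r * (a - L * z) = (r * a - L * b) + L * (b - r * z) := by ring
  rw [this]
  exact add_mem hb (I.mul_mem_left _ hz)

/-- If powers of `x` and `y` kill `f` modulo `K` and `f ∉ K`, then some multiple of `f` outside `K`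
is killed by `x` and `y`. -/
lemma exists_mul_notMem_of_pow_mul_mem {K : Ideal A} {x y f : A} {m n : ℕ} (hf : f ∉ K)
    (hx : x ^ m * f ∈ K) (hy : y ^ n * f ∈ K) :
    ∃ g, g * f ∉ K ∧ x * (g * f) ∈ K ∧ y * (g * f) ∈ K := by
  classical
  have ex : ∃ m, x ^ m * f ∈ K := ⟨m, hx⟩
  -- Least exponents are taken, first of `x` on `f` and then of `y` on `x ^ i * f`. They are
  -- positive because these elements are outside `K`, so one factor can be removed.
  obtain ⟨i, hi⟩ : ∃ i, Nat.find ex = i + 1 := by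
    refine Nat.exists_eq_succ_of_ne_zero fun h0 => hf ?_
    simpa [h0] using Nat.find_spec ex
  have hi1 : x ^ i * f ∉ K := Nat.find_min ex (by omega)
  have hi2 : x ^ (i + 1) * f ∈ K := hi ▸ Nat.find_spec ex
  have ey : ∃ n, y ^ n * (x ^ i * f) ∈ K :=
    ⟨n, by rw [mul_left_comm]; exact K.mul_mem_left _ hy⟩
  obtain ⟨j, hj⟩ : ∃ j, Nat.find ey = j + 1 := by
    refine Nat.exists_eq_succ_of_ne_zero fun h0 => hi1 ?_
    simpa [h0] using Nat.find_spec ey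
  have hj1 : y ^ j * (x ^ i * f) ∉ K := Nat.find_min ey (by omega)
  have hj2 : y ^ (j + 1) * (x ^ i * f) ∈ K := hj ▸ Nat.find_spec ey
  refine ⟨y ^ j * x ^ i, by rwa [mul_assoc], ?_, ?_⟩
  · rw [show x * (y ^ j * x ^ i * f) = y ^ j * (x ^ (i + 1) * f) by ring]
    exact K.mul_mem_left _ hi2
  · rwa [show y * (y ^ j * x ^ i * f) = y ^ (j + 1) * (x ^ i * f) by ring]

/-- By incomparability, a strict chain of primes contracts to a strict chain, whether or not the
ring map is injective. -/
lemma ringKrullDim_le_of_isIntegral (A B : Type*) [CommRing A] [CommRing B] [Algebra A B]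
    [Algebra.IsIntegral A B] : ringKrullDim B ≤ ringKrullDim A :=
  Order.krullDim_le_of_strictMono (PrimeSpectrum.comap (algebraMap A B)) fun _ _ h =>
    Ideal.IsIntegral.comap_lt_comap h

end Regular

/-! ### The two implications. -/

section Main

variable {k : Type*} [Field k] {Z : Finset (ℙ k (Fin 2 → k) × ℙ k (Fin 2 → k))} {c d : k}

lemma maxHomogeneousIdeal_le (c d : k) {K : Ideal (CoordRing k)}
    (hx0 : xForm c ∈ K) (hx1 : X (Sum.inl 1) ∈ K) (hy0 : yForm d ∈ K) (hy1 : X (Sum.inr 1) ∈ K) :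
    maxHomogeneousIdeal k ≤ K := by
  refine Ideal.span_le.2 ?_
  rintro _ ⟨s, rfl⟩
  rcases s with s | s <;> fin_cases s
  · exact (Submodule.sub_mem_iff_left K (K.mul_mem_left (C c) hx1)).1 hx0
  · exact hx1
  · exact (Submodule.sub_mem_iff_left K (K.mul_mem_left (C d) hy1)).1 hy0
  · exact hy1

lemma firstDifference_eq (H : ℕ × ℕ → ℕ) (i : ℕ × ℕ) :
    firstDifference H i = H (i.1, i.2) - (if 1 ≤ i.2 then (H (i.1, i.2 - 1) : ℤ) else 0) -
      (if 1 ≤ i.1 then (H (i.1 - 1, i.2) : ℤ) -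
        (if 1 ≤ i.2 then (H (i.1 - 1, i.2 - 1) : ℤ) else 0) else 0) := by
  simp only [firstDifference, Finset.sum_range_succ, Finset.sum_range_zero]
  by_cases h1 : 1 ≤ i.1 <;> by_cases h2 : 1 ≤ i.2 <;> simp [h1, h2] <;> ring

/-- The first difference of `H_Z`, in terms of the Hilbert function modulo a nonzerodivisor of
bidegree `(1, 0)`. -/
lemma firstDifference_hilbertFunction [Infinite k] (hc : ∀ P ∈ Z, Avoids c P.1) (n : ℕ × ℕ) :
    firstDifference (hilbertFunction coordDeg (idealOfPoints Z)) n =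
      (hilbertFunction coordDeg (idealOfPoints Z ⊔ Ideal.span {xForm c}) n : ℤ) -
        if 1 ≤ n.2 then
          (hilbertFunction coordDeg (idealOfPoints Z ⊔ Ideal.span {xForm c}) (n.1, n.2 - 1) : ℤ)
        else 0 := by
  have key : ∀ n : ℕ × ℕ,
      (hilbertFunction coordDeg (idealOfPoints Z ⊔ Ideal.span {xForm c}) n : ℤ) =
      hilbertFunction coordDeg (idealOfPoints Z) n -
        if 1 ≤ n.1 then (hilbertFunction coordDeg (idealOfPoints Z) (n.1 - 1, n.2) : ℤ) else 0 := by
    rintro ⟨i, j⟩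
    split_ifs with h
    · have := hilbertFunction_sup_span_of_regular coordDeg_ne_zero
        (isHomogeneous_idealOfPoints Z) (isWeightedHomogeneous_xForm c) (xForm_ne_zero c)
        (mem_of_xForm_mul_mem hc) (i - 1, j)
      simp only [Prod.mk_add_mk, Nat.sub_add_cancel h, add_zero] at this
      dsimp only
      omega
    · rw [hilbertFunction_sup_span_of_not_le coordDeg_ne_zero
        (isHomogeneous_idealOfPoints Z) (isWeightedHomogeneous_xForm c), sub_zero]
      intro hle
      exact h hle.1
  rw [firstDifference_eq, key, key]
  split_ifs <;> ring

lemma pow_card_mem_sup_xForm [Infinite k] (hc : ∀ P ∈ Z, Avoids c P.1) :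
    X (Sum.inl 1) ^ Z.card ∈ idealOfPoints Z ⊔ Ideal.span {xForm c} := by
  obtain ⟨t, ht⟩ := exists_prod_sub_xForm_mem hc
  exact pow_card_mem_of_prod_mem (Ideal.mem_sup_left ht)
    (Ideal.mem_sup_right (Ideal.mem_span_singleton_self _))

/-- If `R/I_Z` has depth two, a form `y₀ - d y₁` not vanishing on `Z` is regular modulo `I_Z` and
`x₀ - c x₁`. -/
lemma mem_of_yForm_mul_mem_of_depth_eq_two [Infinite k] (hc : ∀ P ∈ Z, Avoids c P.1)
    (hd : ∀ P ∈ Z, Avoids d P.2)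
    (hdepth : depth (maxHomogeneousIdeal k) (CoordRing k ⧸ idealOfPoints Z) = 2)
    (f : CoordRing k) (hf : yForm d * f ∈ idealOfPoints Z ⊔ Ideal.span {xForm c}) :
    f ∈ idealOfPoints Z ⊔ Ideal.span {xForm c} := by
  obtain ⟨r, hr, s, hs, h1, h2⟩ := exists_regular_pair_of_depth_eq_two hdepth
  by_contra hfK
  have hy : X (Sum.inr 1) ^ Z.card * f ∈ idealOfPoints Z ⊔ Ideal.span {xForm c} := by
    obtain ⟨t, ht⟩ := exists_prod_sub_yForm_mem hd
    -- The ideal used here is the colon ideal `(I₁ : f)`. It contains `I_Z` and, by `hf`, the form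
    -- `y₀ - d y₁`, hence a power of `y₁`.
    exact pow_card_mem_of_prod_mem
      (I := Submodule.comap (LinearMap.mulRight (CoordRing k) f)
        (idealOfPoints Z ⊔ Ideal.span {xForm c}))
      (Ideal.mul_mem_right _ _ (Ideal.mem_sup_left ht)) hf
  obtain ⟨g, hg, hgx, hgy⟩ := exists_mul_notMem_of_pow_mul_mem hfK
    (Ideal.mul_mem_right f _ (pow_card_mem_sup_xForm hc)) hy
  refine hg (mem_of_forall_mul_mem hr hs h1 h2 (mem_of_xForm_mul_mem hc) fun m hm => ?_)
  refine maxHomogeneousIdeal_le c d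
    (K := Submodule.comap (LinearMap.mulRight (CoordRing k) (g * f))
      (idealOfPoints Z ⊔ Ideal.span {xForm c})) ?_ hgx ?_ hgy hm
  · exact Ideal.mul_mem_right _ _ (Ideal.mem_sup_right (Ideal.mem_span_singleton_self _))
  · show yForm d * (g * f) ∈ idealOfPoints Z ⊔ Ideal.span {xForm c}
    rw [mul_left_comm]
    exact Ideal.mul_mem_left _ _ hf

lemma isHilbertFunctionOfArtinianQuotient_of_isACM [Infinite k] (h : IsACM Z) :
    IsHilbertFunctionOfArtinianQuotient k
      (firstDifference (hilbertFunction coordDeg (idealOfPoints Z))) := by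
  classical
  obtain ⟨c, d, hc, hd, -⟩ := exists_avoids_and_eval_ne_zero Z ∅ 0 (by simp) (by simp)
  set I₁ := idealOfPoints Z ⊔ Ideal.span {xForm c} with hI₁
  have hI₁h := isHomogeneous_sup_span (isHomogeneous_idealOfPoints Z)
    (isWeightedHomogeneous_xForm c)
  set I₂ := I₁ ⊔ Ideal.span {yForm d} with hI₂
  have hx : xForm c ∈ I₂ :=
    Ideal.mem_sup_left (Ideal.mem_sup_right (Ideal.mem_span_singleton_self _))
  have hy : yForm d ∈ I₂ := Ideal.mem_sup_right (Ideal.mem_span_singleton_self _)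
  refine ⟨monomialIdeal I₂, isHomogeneous_monomialIdeal I₂,
    isArtinianRing_quotient_of_pow_mem (s := Z.card) ?_ ?_, fun n => ?_⟩
  · have := (pow_mul_pow_mem_monomialIdeal_iff I₂ (Z.card, 0)).2
      (by simpa using Ideal.mem_sup_left (pow_card_mem_sup_xForm hc))
    simpa using this
  · obtain ⟨t, ht⟩ := exists_prod_sub_yForm_mem hd
    have := (pow_mul_pow_mem_monomialIdeal_iff I₂ (0, Z.card)).2
      (by simpa using
        pow_card_mem_of_prod_mem (Ideal.mem_sup_left (Ideal.mem_sup_left ht)) hy)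
    simpa using this
  -- Both Hilbert functions are indicators of the power products outside `I₂`.
  · have hJ : hilbertFunction artinDeg (monomialIdeal I₂) n = hilbertFunction coordDeg I₂ n := by
      rw [hilbertFunction_artinDeg_eq, hilbertFunction_coordDeg_eq hx hy]
      simp only [pow_mul_pow_mem_monomialIdeal_iff]
    rw [firstDifference_hilbertFunction hc, hJ, ← hI₁]
    obtain ⟨i, j⟩ := n
    split_ifs with hj
    · have := hilbertFunction_sup_span_of_regular coordDeg_ne_zero hI₁h
        (isWeightedHomogeneous_yForm d) (yForm_ne_zero d)
        (mem_of_yForm_mul_mem_of_depth_eq_two hc hd h.2) (i, j - 1)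
      simp only [Prod.mk_add_mk, Nat.sub_add_cancel hj, add_zero] at this
      rw [← hI₁, ← hI₂] at this
      dsimp only
      omega
    · rw [hI₂, hilbertFunction_sup_span_of_not_le coordDeg_ne_zero hI₁h
        (isWeightedHomogeneous_yForm d), sub_zero]
      intro hle
      exact hj hle.2

/-- The substitution `x₀ ↦ c x₁` kills `xForm c`, fixes `yForm d` and is the identity modulo `xForm
c`, so the cancellation can be made in the polynomial ring, a domain. -/
lemma mem_span_xForm_of_yForm_mul_mem {f : CoordRing k}
    (h : yForm d * f ∈ Ideal.span {xForm c}) : f ∈ Ideal.span {xForm c} := by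
  let φ : CoordRing k →ₐ[k] CoordRing k :=
    aeval (Sum.elim ![C c * X (Sum.inl 1), X (Sum.inl 1)] ![X (Sum.inr 0), X (Sum.inr 1)])
  have hφx : φ (xForm c) = 0 := by simp [φ, xForm]
  have hφy : φ (yForm d) = yForm d := by simp [φ, yForm]
  have hφ : (Ideal.Quotient.mkₐ k (Ideal.span {xForm c})).comp φ =
      Ideal.Quotient.mkₐ k (Ideal.span {xForm c}) := by
    refine algHom_ext fun s => ?_
    rcases s with s | s <;> fin_cases s
    · have := mk_xForm_eq (Ideal.mem_span_singleton_self (xForm c))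
      rw [mul_comm] at this
      simpa [φ] using this.symm
    all_goals simp [φ]
  obtain ⟨g, hg⟩ := Ideal.mem_span_singleton.1 h
  have h0 : yForm d * φ f = 0 := by
    rw [← hφy, ← map_mul, hg, map_mul, hφx, zero_mul]
  have hf : φ f = 0 := (mul_eq_zero.1 h0).resolve_left (yForm_ne_zero d)
  have := DFunLike.congr_fun hφ f
  rw [AlgHom.comp_apply, hf, map_zero] at this
  exact Ideal.Quotient.eq_zero_iff_mem.1 this.symm

/-- Coordinates `c`, `d` such that every bidegree `n` in which `I_Z` has a nonzero form has its
power product of `x₁` and `y₁` in the ideal generated by `I_Z`, `x₀ - c x₁` and `y₀ - d y₁`. -/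
lemma exists_avoids_and_pow_mul_pow_mem [Infinite k]
    (Z : Finset (ℙ k (Fin 2 → k) × ℙ k (Fin 2 → k))) :
    ∃ c d : k, (∀ P ∈ Z, Avoids c P.1) ∧ (∀ P ∈ Z, Avoids d P.2) ∧
      ∀ n f, IsWeightedHomogeneous coordDeg f n → f ∈ idealOfPoints Z → f ≠ 0 →
        X (Sum.inl 1) ^ n.1 * X (Sum.inr 1) ^ n.2 ∈
          idealOfPoints Z ⊔ Ideal.span {xForm c} ⊔ Ideal.span {yForm d} := by
  classical
  let p : ℕ × ℕ → CoordRing k → Prop := fun n f =>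
    IsWeightedHomogeneous coordDeg f n ∧ f ∈ idealOfPoints Z ∧ f ≠ 0
  let F : ℕ × ℕ → CoordRing k := fun n => if h : ∃ f, p n f then h.choose else 0
  have hF : ∀ n, (∃ f, p n f) → p n (F n) := fun n h => by
    simp only [F, dif_pos h]
    exact h.choose_spec
  -- Genericity need only be imposed in this finite box: outside it, `x₁ ^ Z.card` or `y₁ ^ Z.card`
  -- already lies in the ideal. One nonzero form per bidegree is enough.
  let s := (Finset.range Z.card ×ˢ Finset.range Z.card).filter fun n => ∃ f, p n f
  obtain ⟨c, d, hc, hd, h⟩ := exists_avoids_and_eval_ne_zero Z s F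
    (fun n hn => (hF n (Finset.mem_filter.1 hn).2).1)
    (fun n hn => (hF n (Finset.mem_filter.1 hn).2).2.2)
  refine ⟨c, d, hc, hd, fun n f hf hfI hf0 => ?_⟩
  have hy : yForm d ∈ idealOfPoints Z ⊔ Ideal.span {xForm c} ⊔ Ideal.span {yForm d} :=
    Ideal.mem_sup_right (Ideal.mem_span_singleton_self _)
  by_cases h1 : Z.card ≤ n.1
  · rw [← Nat.sub_add_cancel h1, pow_add, mul_assoc]
    exact Ideal.mul_mem_left _ _ (Ideal.mul_mem_right _ _
      (Ideal.mem_sup_left (pow_card_mem_sup_xForm hc)))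
  by_cases h2 : Z.card ≤ n.2
  · obtain ⟨t, ht⟩ := exists_prod_sub_yForm_mem hd
    rw [← Nat.sub_add_cancel h2, pow_add]
    exact Ideal.mul_mem_left _ _ (Ideal.mul_mem_left _ _
      (pow_card_mem_of_prod_mem (Ideal.mem_sup_left (Ideal.mem_sup_left ht)) hy))
  · have hn : n ∈ s := by
      simp only [s, Finset.mem_filter, Finset.mem_product, Finset.mem_range]
      exact ⟨⟨by omega, by omega⟩, f, hf, hfI, hf0⟩
    have hFn := hF n (Finset.mem_filter.1 hn).2
    exact pow_mul_pow_mem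
      (Ideal.mem_sup_left (Ideal.mem_sup_right (Ideal.mem_span_singleton_self _))) hy hFn.1
      (Ideal.mem_sup_left (Ideal.mem_sup_left hFn.2.1)) (h n hn)

lemma mem_of_yForm_mul_mem_of_firstDifference_nonneg [Infinite k] (hc : ∀ P ∈ Z, Avoids c P.1)
    (hgen : ∀ n f, IsWeightedHomogeneous coordDeg f n → f ∈ idealOfPoints Z → f ≠ 0 →
      X (Sum.inl 1) ^ n.1 * X (Sum.inr 1) ^ n.2 ∈
        idealOfPoints Z ⊔ Ideal.span {xForm c} ⊔ Ideal.span {yForm d})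
    (hnonneg : ∀ n, 0 ≤ firstDifference (hilbertFunction coordDeg (idealOfPoints Z)) n)
    (f : CoordRing k) (hf : yForm d * f ∈ idealOfPoints Z ⊔ Ideal.span {xForm c}) :
    f ∈ idealOfPoints Z ⊔ Ideal.span {xForm c} := by
  classical
  have hI₁h := isHomogeneous_sup_span (isHomogeneous_idealOfPoints Z)
    (isWeightedHomogeneous_xForm c)
  refine mem_of_mul_mem_of_forall_isWeightedHomogeneous hI₁h (isWeightedHomogeneous_yForm d)
    (fun n f hfn hLf => ?_) f hf
  -- If the power product is in `I₂`, then `R/I₂` is zero in bidegree `n + (0, 1)`, and the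
  -- inequality needed is exactly `ΔH ≥ 0` there. If not, `hgen` says that `I_Z` has no nonzero form
  -- in that bidegree, so only `(xForm c)` contributes.
  by_cases hM : X (Sum.inl 1) ^ (n + (0, 1)).1 * X (Sum.inr 1) ^ (n + (0, 1)).2 ∈
      idealOfPoints Z ⊔ Ideal.span {xForm c} ⊔ Ideal.span {yForm d}
  · refine mem_of_mul_mem_of_hilbertFunction_le coordDeg_ne_zero hI₁h
      (isWeightedHomogeneous_yForm d) (yForm_ne_zero d) ?_ hfn hLf
    rw [hilbertFunction_coordDeg_eq
      (Ideal.mem_sup_left (Ideal.mem_sup_right (Ideal.mem_span_singleton_self _)))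
      (Ideal.mem_sup_right (Ideal.mem_span_singleton_self _)), if_pos hM, zero_add]
    have h := hnonneg (n + (0, 1))
    rw [firstDifference_hilbertFunction hc, if_pos (by simp)] at h
    simp only [Prod.fst_add, Prod.snd_add, add_zero, Nat.add_sub_cancel, Prod.mk.eta] at h
    omega
  · refine Ideal.mem_sup_right (mem_span_xForm_of_yForm_mul_mem (d := d) ?_)
    obtain ⟨h, hh, _, hg, heq⟩ := Submodule.mem_sup.1 hLf
    have hcomp : weightedHomogeneousComponent coordDeg (n + (0, 1)) h = 0 := by
      by_contra h0
      exact hM (hgen _ _ (weightedHomogeneousComponent_isWeightedHomogeneous _ h)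
        (weightedHomogeneousComponent_mem_of_mem k coordDeg (isHomogeneous_idealOfPoints Z) hh _)
        h0)
    have hLn : IsWeightedHomogeneous coordDeg (yForm d * f) (n + (0, 1)) := by
      rw [add_comm]
      exact (isWeightedHomogeneous_yForm d).mul hfn
    rw [← weightedHomogeneousComponent_eq_self hLn, ← heq, map_add, hcomp, zero_add]
    refine weightedHomogeneousComponent_mem_of_mem k coordDeg (Ideal.homogeneous_span _ _ ?_) hg _
    rintro _ rfl
    exact ⟨_, isWeightedHomogeneous_xForm c⟩

/-- The two avoiding linear forms act as parameters: `R/I_Z` is integral over a polynomial ring in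
two variables mapped to them, by the monic products of linear forms attached to the points. -/
lemma ringKrullDim_quotient_idealOfPoints_le [Infinite k] (hc : ∀ P ∈ Z, Avoids c P.1)
    (hd : ∀ P ∈ Z, Avoids d P.2) : ringKrullDim (CoordRing k ⧸ idealOfPoints Z) ≤ 2 := by
  let mk := Ideal.Quotient.mkₐ k (idealOfPoints Z)
  let ψ : MvPolynomial (Fin 2) k →ₐ[k] CoordRing k ⧸ idealOfPoints Z :=
    aeval ![mk (xForm c), mk (yForm d)]
  let _ : Algebra (MvPolynomial (Fin 2) k) (CoordRing k ⧸ idealOfPoints Z) := ψ.toRingHom.toAlgebra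
  have hmap : ∀ p, algebraMap (MvPolynomial (Fin 2) k) (CoordRing k ⧸ idealOfPoints Z) p = ψ p :=
    fun _ => rfl
  have hprod : ∀ (t : ℙ k (Fin 2 → k) × ℙ k (Fin 2 → k) → k) (i : Fin 2) (x L : CoordRing k),
      ψ (X i) = mk L → ∏ P ∈ Z, (x - C (t P) * L) ∈ idealOfPoints Z →
      IsIntegral (MvPolynomial (Fin 2) k) (mk x) := by
    intro t i x L hL h
    refine ⟨∏ P ∈ Z, (Polynomial.X - Polynomial.C (C (t P) * X i)),
      Polynomial.monic_prod_of_monic _ _ fun P _ => Polynomial.monic_X_sub_C _, ?_⟩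
    have h' : mk (∏ P ∈ Z, (x - C (t P) * L)) = 0 := Ideal.Quotient.eq_zero_iff_mem.2 h
    rw [Polynomial.eval₂_finsetProd, ← h', map_prod]
    refine Finset.prod_congr rfl fun P _ => ?_
    rw [Polynomial.eval₂_sub, Polynomial.eval₂_X, Polynomial.eval₂_C, hmap, map_mul, map_sub,
      map_mul, hL]
    congr 2
    rw [← algebraMap_eq, ← algebraMap_eq, AlgHom.commutes, AlgHom.commutes]
  have hx1 : IsIntegral (MvPolynomial (Fin 2) k) (mk (X (Sum.inl 1))) := by
    obtain ⟨t, ht⟩ := exists_prod_sub_xForm_mem hc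
    exact hprod t 0 _ _ (by simp [ψ]) ht
  have hy1 : IsIntegral (MvPolynomial (Fin 2) k) (mk (X (Sum.inr 1))) := by
    obtain ⟨t, ht⟩ := exists_prod_sub_yForm_mem hd
    exact hprod t 1 _ _ (by simp [ψ]) ht
  have hC : ∀ a : k, IsIntegral (MvPolynomial (Fin 2) k) (mk (C a)) := fun a => by
    have : mk (C a) = algebraMap (MvPolynomial (Fin 2) k) _ (C a) := by
      rw [hmap, ← algebraMap_eq, ← algebraMap_eq, AlgHom.commutes, AlgHom.commutes]
    rw [this]
    exact isIntegral_algebraMap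
  have hx0 : IsIntegral (MvPolynomial (Fin 2) k) (mk (X (Sum.inl 0))) := by
    have : mk (X (Sum.inl 0)) = algebraMap (MvPolynomial (Fin 2) k) _ (X 0) +
        mk (C c) * mk (X (Sum.inl 1)) := by
      rw [hmap, ← map_mul]
      simp [ψ, xForm]
    rw [this]
    exact isIntegral_algebraMap.add ((hC c).mul hx1)
  have hy0 : IsIntegral (MvPolynomial (Fin 2) k) (mk (X (Sum.inr 0))) := by
    have : mk (X (Sum.inr 0)) = algebraMap (MvPolynomial (Fin 2) k) _ (X 1) +
        mk (C d) * mk (X (Sum.inr 1)) := by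
      rw [hmap, ← map_mul]
      simp [ψ, yForm]
    rw [this]
    exact isIntegral_algebraMap.add ((hC d).mul hy1)
  have hint : Algebra.IsIntegral (MvPolynomial (Fin 2) k) (CoordRing k ⧸ idealOfPoints Z) := by
    refine ⟨fun z => ?_⟩
    obtain ⟨f, rfl⟩ := Ideal.Quotient.mkₐ_surjective k (idealOfPoints Z) z
    induction f using MvPolynomial.induction_on with
    | C a => exact hC a
    | add p q hp hq => rw [map_add]; exact hp.add hq
    | mul_X p s hp =>
      rw [map_mul]
      refine hp.mul ?_
      rcases s with s | s <;> fin_cases s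
      exacts [hx0, hx1, hy0, hy1]
  refine (ringKrullDim_le_of_isIntegral (MvPolynomial (Fin 2) k) _).trans ?_
  rw [MvPolynomial.ringKrullDim_of_isNoetherianRing, ringKrullDim_eq_zero_of_field]
  simp

lemma isACM_of_firstDifference_nonneg [Infinite k] (hZ : Z.Nonempty)
    (hnonneg : ∀ n, 0 ≤ firstDifference (hilbertFunction coordDeg (idealOfPoints Z)) n) :
    IsACM Z := by
  obtain ⟨c, d, hc, hd, hgen⟩ := exists_avoids_and_pow_mul_pow_mem Z
  have hne : idealOfPoints Z ⊔ Ideal.span {xForm c} ⊔ Ideal.span {yForm d} ≠ ⊤ := by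
    obtain ⟨P, hP⟩ := hZ
    have hle : idealOfPoints Z ⊔ Ideal.span {xForm c} ⊔ Ideal.span {yForm d} ≤
        RingHom.ker (eval (0 : Fin 2 ⊕ Fin 2 → k)) := by
      refine sup_le (sup_le (Ideal.span_le.2 ?_) ?_) ?_
      · rintro f ⟨⟨n, hf⟩, hfZ⟩
        -- Scaling a representative of `P` by zero gives the origin. The value at `P` is zero, so
        -- the argument also covers bidegree `(0, 0)`, where `0 ^ 0 = 1`; this is where a point of
        -- `Z` is needed.
        have h0 := aeval_mul_of_isWeightedHomogeneous hf (0 : k) 0 P.1.rep P.2.rep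
        have hv : aeval (Sum.elim P.1.rep P.2.rep) f = 0 :=
          hfZ P hP _ _ P.1.rep_nonzero P.2.rep_nonzero P.1.mk_rep P.2.mk_rep
        have hs : (Sum.elim (fun i => 0 * P.1.rep i) fun i => 0 * P.2.rep i) = 0 := by
          ext s
          rcases s with s | s <;> simp
        rw [hs, hv, mul_zero] at h0
        exact h0
      · rw [Ideal.span_singleton_le_iff_mem]
        simp [xForm]
      · rw [Ideal.span_singleton_le_iff_mem]
        simp [yForm]
    exact fun h => RingHom.ker_ne_top _ (top_le_iff.1 (h ▸ hle))
  have hreg := isRegular_pair (mem_of_xForm_mul_mem hc)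
    (mem_of_yForm_mul_mem_of_firstDifference_nonneg hc hgen hnonneg) hne
  have hdim := ringKrullDim_quotient_idealOfPoints_le hc hd
  have hlen := length_le_supportDim _ _ hreg
  rw [Module.supportDim_quotient_eq_ringKrullDim] at hlen
  -- The regular pair bounds dimension and depth below by two, while integrality bounds the
  -- dimension, and with it the depth, above by two.
  refine ⟨le_antisymm hdim hlen, le_antisymm (depth_le_of_supportDim_le (n := 2) ?_) ?_⟩
  · rwa [Module.supportDim_quotient_eq_ringKrullDim]
  · refine length_le_depth (fun r hr => ?_) hreg
    rcases List.mem_pair.1 hr with rfl | rfl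
    exacts [xForm_mem_maxHomogeneousIdeal c, yForm_mem_maxHomogeneousIdeal d]

end Main

end BigradedPoints

theorem theorem3p1 {k : Type*} [Field k] [IsAlgClosed k] [CharZero k]
    (X : Finset (ℙ k (Fin 2 → k) × ℙ k (Fin 2 → k))) (hX : X.Nonempty) :
    BigradedPoints.IsACM X ↔
      BigradedPoints.IsHilbertFunctionOfArtinianQuotient k
        (BigradedPoints.firstDifference
          (BigradedPoints.hilbertFunction BigradedPoints.coordDeg
            (BigradedPoints.idealOfPoints X))) := by
  refine ⟨BigradedPoints.isHilbertFunctionOfArtinianQuotient_of_isACM, ?_⟩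
  rintro ⟨J, -, -, hJ⟩
  refine BigradedPoints.isACM_of_firstDifference_nonneg hX fun n => ?_
  rw [hJ]
  exact Int.natCast_nonneg _
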